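/- Let $X$ be a nonempty compact metric space with metric $d$ and $T:X\to X$ a continuous map. Assume that $(X,T)$ has the shadowing property: for every $\varepsilon>0$ there is $\delta>0$ such that for every sequence $(x_n)_{n\ge 0}$ in $X$ with $d(T(x_n),x_{n+1})\le\delta$ for all $n\ge 0$ there is $y\in X$ with $d(x_n,T^n(y))\le\varepsilon$ for all $n\ge 0$. Definitions. A set $I\subseteq\mathbb N$ has positive density if $\liminf_{n}|I\cap[1,n]|/n>0$, and it is an independence set for $\{A_1,A_2\}$, where $A_1,A_2\subseteq X$, if $\bigcap_{j\in J}T^{-j}(Y_j)\neq\emptyset$ for every finite $J\subseteq I$ and every choice $Y_j\in\{A_1,A_2\}$ $(j\in J)$. Let $E=E(X,T)\subseteq X\times X$ be the set of IE-pairs, i.e. of pairs $(x_1,x_2)$ such that for all open sets $A_1\ni x_1$, $A_2\ni x_2$ there is an independence set for $\{A_1,A_2\}$ of positive density. Let $E^+$ be the set of pairs $(u,v)$ for which there are $n\ge 2$ and $u=u_1,\dots,u_n=v$ in $X$ with $(u_i,u_{i+1})\in E$ for $1\le i<n$. For an open cover $\mathcal U$, let $N(\mathcal U)$ be the least cardinality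 of a subcover, $h_{\mathrm{top}}(T,\mathcal U)=\lim_{n\to\infty}\frac1n\log N\big(\bigvee_{m=1}^{n}T^{-m}\mathcal U\big)$, and let $h_{\mathrm{top}}(T)$ be the supremum of $h_{\mathrm{top}}(T,\mathcal U)$ over all open covers $\mathcal U$. The system $(X,T)$ has completely positive entropy (CPE) if $h_{\mathrm{top}}(S)>0$ for every factor $(Y,S)$ with at least two points; here a factor consists of a compact metrizable space $Y$ and a continuous map $S:Y\to Y$ for which there is a continuous surjection $\varphi:X\to Y$ with $\varphi\circ T=S\circ\varphi$. It has uniform positive entropy (UPE) if $h_{\mathrm{top}}(T,\{U,V\})>0$ for every open cover $\{U,V\}$ of $X$ by two non-dense sets. Then: (1) $E$ is a transitive relation, i.e. $E=E^+$; (2) $(X,T)$ has UPE if and only if it has CPE; (3) moreover, (2) also holds with UPE replaced by the condition that $h_{\mathrm{top}}(T,\mathcal U)>0$ for every finite open cover $\mathcal U$ of $X$ consisting of non-dense sets. -/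

import Mathlib

open Filter Topology Set

namespace LocalEntropy

section Covers

variable {X : Type*}

/-- A family of open sets whose union is the whole space. -/
def IsCoverByOpens [TopologicalSpace X] (𝒰 : Set (Set X)) : Prop :=
  (∀ U ∈ 𝒰, IsOpen U) ∧ ⋃₀ 𝒰 = univ

/-- `N(𝒰)`: the smallest cardinality of a (finite) subcover of `𝒰`. -/
noncomputable def coverNumber (𝒰 : Set (Set X)) : ℕ :=
  sInf {k | ∃ 𝒱 ⊆ 𝒰, 𝒱.Finite ∧ ⋃₀ 𝒱 = univ ∧ 𝒱.ncard = k}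

/-- The join `T⁻¹ 𝒰 ∨ T⁻² 𝒰 ∨ ⋯ ∨ T⁻ⁿ 𝒰`: all sets `⋂_{m = 1}^n T⁻ᵐ U_m` with `U_m ∈ 𝒰`. -/
def iterJoin (T : X → X) (𝒰 : Set (Set X)) (n : ℕ) : Set (Set X) :=
  {W | ∃ U : ℕ → Set X, (∀ m ∈ Finset.Icc 1 n, U m ∈ 𝒰) ∧
    W = ⋂ m ∈ Finset.Icc 1 n, T^[m] ⁻¹' U m}

/-- The entropy of `T` with respect to the cover `𝒰`,
`lim_{n → ∞} (1 / n) log N(T⁻¹ 𝒰 ∨ ⋯ ∨ T⁻ⁿ 𝒰)`.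
The limit exists for open covers of compact spaces, see `tendsto_coverEntropy`. -/
noncomputable def coverEntropy (T : X → X) (𝒰 : Set (Set X)) : ℝ :=
  limUnder atTop fun n : ℕ => Real.log (coverNumber (iterJoin T 𝒰 n)) / n

/-- The topological entropy: supremum of the entropies with respect to open covers. -/
noncomputable def topEntropy [TopologicalSpace X] (T : X → X) : EReal :=
  ⨆ (𝒰 : Set (Set X)) (_ : IsCoverByOpens 𝒰), (coverEntropy T 𝒰 : EReal)

theorem isCoverByOpens_iterJoin [TopologicalSpace X] {T : X → X} (hT : Continuous T)
    {𝒰 : Set (Set X)} (h𝒰 : IsCoverByOpens 𝒰) (n : ℕ) : IsCoverByOpens (iterJoin T 𝒰 n) := by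
  refine ⟨?_, ?_⟩
  · rintro W ⟨U, hU, rfl⟩
    exact isOpen_biInter_finset fun m hm => (h𝒰.1 _ (hU m hm)).preimage (hT.iterate m)
  · refine eq_univ_of_forall fun x => ?_
    have hx : ∀ m : ℕ, ∃ U ∈ 𝒰, T^[m] x ∈ U := fun m => by
      have h : T^[m] x ∈ ⋃₀ 𝒰 := h𝒰.2 ▸ mem_univ _
      exact h
    choose U hU hxU using hx
    exact ⟨_, ⟨U, fun m _ => hU m, rfl⟩, by simpa using fun m _ _ => hxU m⟩

theorem exists_coverNumber [TopologicalSpace X] [CompactSpace X] {𝒰 : Set (Set X)}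
    (h𝒰 : IsCoverByOpens 𝒰) :
    ∃ 𝒱 ⊆ 𝒰, 𝒱.Finite ∧ ⋃₀ 𝒱 = univ ∧ 𝒱.ncard = coverNumber 𝒰 := by
  obtain ⟨𝒱, h1, h2, h3⟩ := isCompact_univ.elim_finite_subcover_image (c := id) h𝒰.1
    (by simpa [← sUnion_eq_biUnion] using h𝒰.2.ge)
  simp only [id, ← sUnion_eq_biUnion] at h3
  exact Nat.sInf_mem (s := {k | ∃ 𝒱 ⊆ 𝒰, 𝒱.Finite ∧ ⋃₀ 𝒱 = univ ∧ 𝒱.ncard = k})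
    ⟨_, 𝒱, h1, h2, univ_subset_iff.1 h3, rfl⟩

theorem coverNumber_pos [TopologicalSpace X] [CompactSpace X] [Nonempty X] {𝒰 : Set (Set X)}
    (h𝒰 : IsCoverByOpens 𝒰) : 0 < coverNumber 𝒰 := by
  obtain ⟨𝒱, -, hf, hc, hn⟩ := exists_coverNumber h𝒰
  rw [← hn, ncard_pos hf]
  rw [nonempty_iff_ne_empty]
  rintro rfl
  simp at hc
  exact empty_ne_univ hc

theorem coverNumber_iterJoin_add_le [TopologicalSpace X] [CompactSpace X] {T : X → X}
    (hT : Continuous T) {𝒰 : Set (Set X)} (h𝒰 : IsCoverByOpens 𝒰) (a b : ℕ) :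
    coverNumber (iterJoin T 𝒰 (a + b)) ≤
      coverNumber (iterJoin T 𝒰 a) * coverNumber (iterJoin T 𝒰 b) := by
  obtain ⟨A, hA, hAf, hAc, hAn⟩ := exists_coverNumber (isCoverByOpens_iterJoin hT h𝒰 a)
  obtain ⟨B, hB, hBf, hBc, hBn⟩ := exists_coverNumber (isCoverByOpens_iterJoin hT h𝒰 b)
  have key : (image2 (fun V W => V ∩ T^[a] ⁻¹' W) A B).ncard ≤ A.ncard * B.ncard := by
    rw [← image_uncurry_prod, ← ncard_prod]
    exact ncard_image_le (hAf.prod hBf)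
  rw [← hAn, ← hBn]
  refine le_trans (Nat.sInf_le ⟨_, ?_, hAf.image2 _ hBf, ?_, rfl⟩) key
  · rintro _ ⟨V, hV, W, hW, rfl⟩
    obtain ⟨P, hP, rfl⟩ := hA hV
    obtain ⟨Q, hQ, rfl⟩ := hB hW
    refine ⟨fun m => if m ≤ a then P m else Q (m - a), fun m hm => ?_, ?_⟩
    · rw [Finset.mem_Icc] at hm
      by_cases h : m ≤ a
      · simpa [h] using hP m (by simp; omega)
      · simpa [h] using hQ (m - a) (by simp; omega)
    · ext x
      simp only [mem_inter_iff, mem_iInter, mem_preimage, Finset.mem_Icc]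
      constructor
      · rintro ⟨h1, h2⟩ m hm
        by_cases h : m ≤ a
        · simpa [h] using h1 m ⟨hm.1, h⟩
        · have := h2 (m - a) (by omega)
          rw [← Function.iterate_add_apply, show m - a + a = m by omega] at this
          simpa [h] using this
      · intro h
        refine ⟨fun m hm => by simpa [hm.2] using h m (by omega), fun m hm => ?_⟩
        have := h (m + a) (by omega)
        rw [← Function.iterate_add_apply]
        simpa [show ¬ (m + a ≤ a) by omega] using this
  · refine eq_univ_of_forall fun x => ?_
    obtain ⟨V, hV, hxV⟩ : x ∈ ⋃₀ A := hAc ▸ mem_univ _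
    obtain ⟨W, hW, hxW⟩ : T^[a] x ∈ ⋃₀ B := hBc ▸ mem_univ _
    exact ⟨_, mem_image2_of_mem hV hW, hxV, hxW⟩

/-- The limit in the definition of `coverEntropy` exists. -/
theorem tendsto_coverEntropy [TopologicalSpace X] [CompactSpace X] [Nonempty X] {T : X → X}
    (hT : Continuous T) {𝒰 : Set (Set X)} (h𝒰 : IsCoverByOpens 𝒰) :
    Tendsto (fun n : ℕ => Real.log (coverNumber (iterJoin T 𝒰 n)) / n) atTop
      (𝓝 (coverEntropy T 𝒰)) := by
  have hpos : ∀ n, (0 : ℝ) < coverNumber (iterJoin T 𝒰 n) := fun n => by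
    exact_mod_cast coverNumber_pos (isCoverByOpens_iterJoin hT h𝒰 n)
  have hsub : Subadditive fun n : ℕ => Real.log (coverNumber (iterJoin T 𝒰 n)) := by
    intro a b
    rw [← Real.log_mul (hpos a).ne' (hpos b).ne']
    exact Real.log_le_log (hpos _) (by exact_mod_cast coverNumber_iterJoin_add_le hT h𝒰 a b)
  refine tendsto_nhds_limUnder ⟨_, hsub.tendsto_lim ⟨0, ?_⟩⟩
  rintro _ ⟨n, rfl⟩
  exact div_nonneg (Real.log_natCast_nonneg _) (Nat.cast_nonneg _)

end Covers

section Entropy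

/-- Completely positive entropy: every non-trivial factor has positive topological entropy.
A factor is a continuous self-map `S` of a compact metrizable space `Y` with a continuous
surjection `φ : X → Y` such that `φ ∘ T = S ∘ φ`; it is non-trivial if `Y` has at least
two points. -/
def HasCPE.{u} {X : Type u} [TopologicalSpace X] (T : X → X) : Prop :=
  ∀ (Y : Type u) [TopologicalSpace Y] [CompactSpace Y] [TopologicalSpace.MetrizableSpace Y]
    (S : Y → Y) (φ : X → Y), Continuous S → Continuous φ → Function.Surjective φ →
    Function.Semiconj φ T S → Nontrivial Y → 0 < topEntropy S

/-- Uniform positive entropy: every open cover by two non-dense sets has positive entropy. -/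
def HasUPE {X : Type*} [TopologicalSpace X] (T : X → X) : Prop :=
  ∀ U V : Set X, IsCoverByOpens {U, V} → ¬ Dense U → ¬ Dense V → 0 < coverEntropy T {U, V}

/-- Uniform positive entropy for all finite covers: every finite open cover by non-dense sets
has positive entropy. -/
def HasFiniteUPE {X : Type*} [TopologicalSpace X] (T : X → X) : Prop :=
  ∀ 𝒰 : Set (Set X), 𝒰.Finite → IsCoverByOpens 𝒰 → (∀ U ∈ 𝒰, ¬ Dense U) → 0 < coverEntropy T 𝒰

end Entropy

section Independence

/-- `liminf_n |I ∩ [1, n]| / n > 0`. -/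
def HasPositiveDensity (I : Set ℕ) : Prop :=
  0 < liminf (fun n : ℕ => ((I ∩ Icc 1 n).ncard : ℝ) / n) atTop

/-- `I` is an independence set for the family `𝒜` of subsets of `X`. -/
def IsIndependenceSet {X : Type*} (T : X → X) (𝒜 : Set (Set X)) (I : Set ℕ) : Prop :=
  ∀ J : Finset ℕ, (J : Set ℕ) ⊆ I → ∀ Y : ℕ → Set X, (∀ j ∈ J, Y j ∈ 𝒜) →
    (⋂ j ∈ J, T^[j] ⁻¹' Y j).Nonempty

/-- `E(X, T)`: the set of independence entropy pairs. -/
def IEPairs {X : Type*} [TopologicalSpace X] (T : X → X) : Set (X × X) :=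
  {p | ∀ A₁ A₂ : Set X, IsOpen A₁ → IsOpen A₂ → p.1 ∈ A₁ → p.2 ∈ A₂ →
    ∃ I : Set ℕ, HasPositiveDensity I ∧ IsIndependenceSet T {A₁, A₂} I}

/-- `F⁺`: all `(u, v)` joined by a chain `u = u₁, …, u_n = v` with at least one step and
`(u_i, u_{i+1}) ∈ F`. -/
def chainClosure {Z : Type*} (F : Set (Z × Z)) : Set (Z × Z) :=
  {p | Relation.TransGen (fun u v => (u, v) ∈ F) p.1 p.2}

end Independence

section Shadowing

variable {X : Type*} [MetricSpace X]

/-- `δ`-pseudo-orbits. -/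
def IsPseudoOrbit (T : X → X) (δ : ℝ) (x : ℕ → X) : Prop :=
  ∀ n, dist (T (x n)) (x (n + 1)) ≤ δ

/-- The shadowing property. -/
def HasShadowing (T : X → X) : Prop :=
  ∀ ε > 0, ∃ δ > 0, ∀ x : ℕ → X, IsPseudoOrbit T δ x →
    ∃ y : X, ∀ n, dist (x n) (T^[n] y) ≤ ε

end Shadowing

end LocalEntropy

/-! Call two points chain related at scale `δ` if `δ`-chains of one common positive length join them
in all four ways. Under shadowing, IE-pairs are exactly the pairs chain related at every scale
(`mem_IEPairs_iff`): two times in an independence set give four orbit segments of equal length, and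
conversely freely concatenated chains are shadowed by orbits. Loops let chain lengths be padded, so
the relation is transitive.

`E` together with the diagonal is therefore a closed invariant equivalence relation, and its
quotient is a metrizable factor. Open covers pulled back from it are saturated; for these, first
visit times to a finite net determine itineraries well enough that cover numbers grow only
polynomially (`coverEntropy_nonpos_of_saturated`). Hence the factor has zero entropy, and CPE makes
it a point: all distinct pairs are IE-pairs.

Then, for a finite cover by non-dense sets, orbits can avoid any prescribed sequence of members
along multiples of some `n`, which makes cover numbers grow exponentially
(`coverEntropy_pos_of_avoiding`). So CPE implies finite UPE; UPE passes to CPE by pulling back a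
two-set cover. -/

namespace LocalEntropy

/-! ### Pseudo-orbit chains and their concatenation -/

section Chains

variable {X : Type*} [MetricSpace X] {T : X → X} {δ : ℝ} {a b c : X} {m n : ℕ}

/-- There is a `δ`-chain of length exactly `n` from `a` to `b`. -/
def HasChain (T : X → X) (δ : ℝ) (n : ℕ) (a b : X) : Prop :=
  ∃ c : ℕ → X, c 0 = a ∧ c n = b ∧ ∀ i < n, dist (T (c i)) (c (i + 1)) ≤ δ

theorem HasChain.refl (T : X → X) (δ : ℝ) (a : X) : HasChain T δ 0 a a :=
  ⟨fun _ => a, rfl, rfl, by simp⟩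

theorem HasChain.trans (h₁ : HasChain T δ m a b) (h₂ : HasChain T δ n b c) :
    HasChain T δ (m + n) a c := by
  obtain ⟨f, f0, fm, hf⟩ := h₁
  obtain ⟨g, g0, gn, hg⟩ := h₂
  refine ⟨fun i => if i ≤ m then f i else g (i - m), by simp [f0], ?_, fun i hi => ?_⟩
  · rcases Nat.eq_zero_or_pos n with rfl | hn
    · simp [fm, ← gn, g0]
    · simp [gn, hn.ne']
  · rcases lt_trichotomy i m with h | rfl | h
    · simpa [h.le, Nat.succ_le_of_lt h] using hf i h
    · simpa [fm, ← g0] using hg 0 (by omega)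
    · simpa [h.not_ge, show ¬ i + 1 ≤ m by omega, show i + 1 - m = i - m + 1 by omega]
        using hg (i - m) (by omega)

theorem HasChain.mul (h : HasChain T δ n a a) (k : ℕ) : HasChain T δ (n * k) a a := by
  induction k with
  | zero => exact HasChain.refl T δ a
  | succ k ih => exact ih.trans h

theorem HasChain.of_loop_left (h : HasChain T δ n a b) (hl : HasChain T δ n a a) {k : ℕ}
    (hk : 0 < k) : HasChain T δ (n * k) a b := by
  obtain ⟨k, rfl⟩ := Nat.exists_eq_add_of_le' hk
  exact (hl.mul k).trans h

theorem HasChain.of_seq {w : ℕ → X} (hw : ∀ i, dist (T (w i)) (w (i + 1)) ≤ δ) {i j : ℕ}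
    (hij : i ≤ j) : HasChain T δ (j - i) (w i) (w j) :=
  ⟨fun k => w (i + k), rfl, by simp [Nat.add_sub_cancel' hij], fun k _ => hw (i + k)⟩

theorem HasChain.iterate (T : X → X) (x : X) {i j : ℕ} (hij : i ≤ j) :
    HasChain T 0 (j - i) (T^[i] x) (T^[j] x) :=
  HasChain.of_seq (w := fun k => T^[k] x)
    (fun k => by simp [Function.iterate_succ_apply']) hij

/-- Four `δ`-chains of a common positive length join `a` and `b` in all possible ways. -/
def ChainRelated (T : X → X) (δ : ℝ) (a b : X) : Prop :=
  ∃ n, 0 < n ∧ HasChain T δ n a a ∧ HasChain T δ n a b ∧ HasChain T δ n b a ∧ HasChain T δ n b b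

theorem ChainRelated.symm (h : ChainRelated T δ a b) : ChainRelated T δ b a := by
  obtain ⟨n, hn, h₁, h₂, h₃, h₄⟩ := h
  exact ⟨n, hn, h₄, h₃, h₂, h₁⟩

/-- Loops at the starting points stretch chains of lengths `m` and `n` to the common length `m * n`,
after which they concatenate. -/
theorem ChainRelated.trans (h₁ : ChainRelated T δ a b) (h₂ : ChainRelated T δ b c) :
    ChainRelated T δ a c := by
  obtain ⟨m, hm, aa, ab, ba, bb⟩ := h₁
  obtain ⟨n, hn, bb', bc, cb, cc⟩ := h₂
  have e : m * n = n * m := mul_comm m n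
  refine ⟨m * n + n * m, by positivity, (aa.mul n).trans (e ▸ aa.mul n),
    (ab.of_loop_left aa hn).trans (bc.of_loop_left bb' hm), ?_, (e ▸ cc.mul m).trans (cc.mul m)⟩
  have := (cb.of_loop_left cc hm).trans (ba.of_loop_left bb hn)
  rwa [add_comm] at this

theorem ChainRelated.refl_left (h : ChainRelated T δ a b) : ChainRelated T δ a a :=
  h.trans h.symm

/-- The product of the lengths for all pairs works: each chain is padded by loops at its source. -/
theorem exists_common_chain_length (F : Finset X)
    (h : ∀ a ∈ F, ∀ b ∈ F, ChainRelated T δ a b) :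
    ∃ n, 0 < n ∧ ∀ a ∈ F, ∀ b ∈ F, HasChain T δ n a b := by
  classical
  have h' : ∀ p : X × X, ∃ n, 0 < n ∧
      (p ∈ F ×ˢ F → HasChain T δ n p.1 p.1 ∧ HasChain T δ n p.1 p.2) := by
    intro p
    by_cases hp : p ∈ F ×ˢ F
    · rw [Finset.mem_product] at hp
      obtain ⟨n, hn, h₁, h₂, -⟩ := h _ hp.1 _ hp.2
      exact ⟨n, hn, fun _ => ⟨h₁, h₂⟩⟩
    · exact ⟨1, one_pos, fun h => absurd h hp⟩
  choose N hN hc using h'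
  refine ⟨∏ p ∈ F ×ˢ F, N p, Finset.prod_pos fun p _ => hN p, fun a ha b hb => ?_⟩
  have hp : (a, b) ∈ F ×ˢ F := Finset.mk_mem_product ha hb
  rw [← Finset.mul_prod_erase _ _ hp]
  exact (hc _ hp).2.of_loop_left (hc _ hp).1 (Finset.prod_pos fun p _ => hN p)

/-- Recurrent steps from related points lead to related points. -/
theorem ChainRelated.step {a' b' : X} {k l : ℕ} (h : a = b ∨ ChainRelated T δ a b)
    (ha : HasChain T δ 1 a a') (ha' : HasChain T δ k a' a)
    (hb : HasChain T δ 1 b b') (hb' : HasChain T δ l b' b) : ChainRelated T δ a' b' := by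
  obtain ⟨n, aa, ab, ba, bb⟩ : ∃ n, HasChain T δ n a a ∧ HasChain T δ n a b ∧
      HasChain T δ n b a ∧ HasChain T δ n b b := by
    rcases h with rfl | ⟨n, -, h⟩
    · exact ⟨0, .refl T δ a, .refl T δ a, .refl T δ a, .refl T δ a⟩
    · exact ⟨n, h⟩
  -- Going round the loop at `a` of length `1 + k` another `l` times makes the return length `k + l
  -- + k * l`, symmetric in `k` and `l`.
  have hal : HasChain T δ (k + (1 + k) * l) a' a := ha'.trans ((ha.trans ha').mul l)
  have hbl : HasChain T δ (l + (1 + l) * k) b' b := hb'.trans ((hb.trans hb').mul k)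
  have e : l + (1 + l) * k = k + (1 + k) * l := by ring
  rw [e] at hbl
  exact ⟨k + (1 + k) * l + n + 1, by positivity, (hal.trans aa).trans ha, (hal.trans ab).trans hb,
    (hbl.trans ba).trans ha, (hbl.trans bb).trans hb⟩

/-- Only the two endpoints of the chain are replaced; `0 < n` keeps them at different indices.
Uniform continuity controls the effect on `T`. -/
theorem HasChain.perturb [CompactSpace X] (hT : Continuous T) (hδ : 0 < δ) :
    ∃ η > 0, ∀ (n : ℕ) (a a' b b' : X), 0 < n → dist a a' ≤ η → dist b b' ≤ η →
      HasChain T η n a b → HasChain T δ n a' b' := by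
  classical
  have hu : UniformContinuous T := CompactSpace.uniformContinuous_of_continuous hT
  obtain ⟨r, hr, hTr⟩ := Metric.uniformContinuous_iff.1 hu (δ / 3) (by positivity)
  refine ⟨min (δ / 3) (r / 2), by positivity, ?_⟩
  rintro n a a' b b' hn haa hbb ⟨c, rfl, rfl, hc⟩
  set c' : ℕ → X := Function.update (Function.update c 0 a') n b' with hc'
  have hd : ∀ i, dist (c i) (c' i) ≤ min (δ / 3) (r / 2) := by
    intro i
    by_cases h1 : i = n
    · subst h1; simpa [hc'] using hbb
    by_cases h2 : i = 0
    · subst h2; simpa [hc', h1] using haa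
    · simpa [hc', h1, h2] using ⟨by positivity, by positivity⟩
  refine ⟨c', by simp [hc', hn.ne], by simp [hc'], fun i hi => ?_⟩
  have h1 : dist (T (c' i)) (T (c i)) < δ / 3 := by
    refine hTr ?_
    rw [dist_comm]
    have := (hd i).trans (min_le_right _ _)
    linarith
  have h2 := (hc i hi).trans (min_le_left _ _)
  have h3 := (hd (i + 1)).trans (min_le_left _ _)
  have h4 := dist_triangle4 (T (c' i)) (T (c i)) (c (i + 1)) (c' (i + 1))
  linarith

theorem HasChain.mono {δ' : ℝ} (h : HasChain T δ n a b) (hδ : δ ≤ δ') : HasChain T δ' n a b := by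
  obtain ⟨c, h0, hn, hc⟩ := h
  exact ⟨c, h0, hn, fun i hi => (hc i hi).trans hδ⟩

theorem ChainRelated.mono {δ' : ℝ} (h : ChainRelated T δ a b) (hδ : δ ≤ δ') :
    ChainRelated T δ' a b := by
  obtain ⟨n, hn, h₁, h₂, h₃, h₄⟩ := h
  exact ⟨n, hn, h₁.mono hδ, h₂.mono hδ, h₃.mono hδ, h₄.mono hδ⟩

theorem ChainRelated.perturb [CompactSpace X] (hT : Continuous T) (hδ : 0 < δ) :
    ∃ η > 0, ∀ a a' b b' : X, dist a a' ≤ η → dist b b' ≤ η →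
      ChainRelated T η a b → ChainRelated T δ a' b' := by
  obtain ⟨η, hη, h⟩ := HasChain.perturb hT hδ
  refine ⟨η, hη, fun a a' b b' haa hbb => ?_⟩
  rintro ⟨n, hn, h₁, h₂, h₃, h₄⟩
  exact ⟨n, hn, h _ _ _ _ _ hn haa haa h₁, h _ _ _ _ _ hn haa hbb h₂,
    h _ _ _ _ _ hn hbb haa h₃, h _ _ _ _ _ hn hbb hbb h₄⟩

theorem ChainRelated.map [CompactSpace X] (hT : Continuous T) (hδ : 0 < δ) :
    ∃ η > 0, ∀ a b : X, ChainRelated T η a b → ChainRelated T δ (T a) (T b) := by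
  have hu : UniformContinuous T := CompactSpace.uniformContinuous_of_continuous hT
  obtain ⟨r, hr, hTr⟩ := Metric.uniformContinuous_iff.1 hu δ hδ
  have key : ∀ n a b, HasChain T (r / 2) n a b → HasChain T δ n (T a) (T b) := by
    rintro n a b ⟨c, rfl, rfl, hc⟩
    exact ⟨fun i => T (c i), rfl, rfl, fun i hi => (hTr ((hc i hi).trans_lt (by linarith))).le⟩
  refine ⟨r / 2, by positivity, fun a b => ?_⟩
  rintro ⟨n, hn, h₁, h₂, h₃, h₄⟩
  exact ⟨n, hn, key _ _ _ h₁, key _ _ _ h₂, key _ _ _ h₃, key _ _ _ h₄⟩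

/-- In a system with shadowing, points that are joined by chains of a common length are
visited in any prescribed order, up to a small error. -/
theorem HasShadowing.exists_iterate (hs : HasShadowing T) (F : Finset X)
    (hF : ∀ δ > 0, ∀ a ∈ F, ∀ b ∈ F, ChainRelated T δ a b) {ε : ℝ} (hε : 0 < ε) :
    ∃ n, 0 < n ∧ ∀ σ : ℕ → X, (∀ k, σ k ∈ F) → ∃ y, ∀ k, dist (σ k) (T^[k * n] y) ≤ ε := by
  obtain ⟨δ, hδ, hsh⟩ := hs ε hε
  obtain ⟨n, hn, hc⟩ := exists_common_chain_length F (hF δ hδ)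
  refine ⟨n, hn, fun σ hσ => ?_⟩
  choose c c0 cn hcs using fun k => hc (σ k) (hσ k) (σ (k + 1)) (hσ (k + 1))
  -- The chains are laid end to end: time `i` is position `i % n` in block `i / n`.
  obtain ⟨y, hy⟩ := hsh (fun i => c (i / n) (i % n)) fun i => by
    have hi := Nat.mod_lt i hn
    have hstep := hcs (i / n) (i % n) hi
    rcases Nat.lt_or_ge (i % n + 1) n with h | h
    · have e1 : (i + 1) / n = i / n := by
        rw [Nat.succ_div, if_neg, add_zero]
        intro hd
        have := Nat.mod_eq_zero_of_dvd hd
        rw [Nat.add_mod, Nat.mod_eq_of_lt (lt_of_le_of_lt (Nat.le_add_left _ _) h),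
          Nat.mod_eq_of_lt h] at this
        omega
      have e2 : (i + 1) % n = i % n + 1 := by
        have h1 := Nat.div_add_mod i n
        have h2 := Nat.div_add_mod (i + 1) n
        rw [e1] at h2
        omega
      simpa [e1, e2] using hstep
    · have e0 : i % n + 1 = n := by omega
      have e : i + 1 = (i / n + 1) * n := by
        have h1 := Nat.div_add_mod i n
        rw [add_mul, one_mul, mul_comm]
        omega
      have e1 : (i + 1) / n = i / n + 1 := by rw [e, Nat.mul_div_cancel _ hn]
      have e2 : (i + 1) % n = 0 := by rw [e, Nat.mul_mod_left]
      rw [e0, cn] at hstep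
      simpa [e1, e2, c0] using hstep
  refine ⟨y, fun k => ?_⟩
  simpa [Nat.mul_div_cancel _ hn, c0] using hy (k * n)

end Chains

/-! ### Independence sets and density -/

section Independence

variable {X : Type*} {T : X → X}

theorem IsIndependenceSet.exists_mem {𝒜 : Set (Set X)} {I : Set ℕ} (h : IsIndependenceSet T 𝒜 I)
    {i j : ℕ} (hi : i ∈ I) (hj : j ∈ I) (hij : i ≠ j) {A B : Set X} (hA : A ∈ 𝒜) (hB : B ∈ 𝒜) :
    ∃ z, T^[i] z ∈ A ∧ T^[j] z ∈ B := by
  classical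
  obtain ⟨z, hz⟩ := h {i, j} (by simp [Set.insert_subset_iff, hi, hj])
    (fun k => if k = i then A else B) (by simp [hA, hij.symm, hB])
  simp only [mem_iInter, mem_preimage] at hz
  exact ⟨z, by simpa using hz i (by simp), by simpa [hij.symm] using hz j (by simp)⟩

theorem half_le_natDiv {n M : ℕ} (hn : 0 < n) (hM : n ≤ M) :
    (M : ℝ) / (2 * n) ≤ (M / n : ℕ) := by
  have h1 : 1 ≤ M / n := (Nat.one_le_div_iff hn).2 hM
  have h2 : M < n * (M / n + 1) := Nat.lt_mul_div_succ M hn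
  have h3 : M ≤ (M / n) * (2 * n) := by nlinarith
  rw [div_le_iff₀ (by positivity)]
  exact_mod_cast h3

theorem density_le_one (I : Set ℕ) (n : ℕ) : ((I ∩ Icc 1 n).ncard : ℝ) / n ≤ 1 := by
  have h : (I ∩ Icc 1 n).ncard ≤ n := by
    refine (ncard_le_ncard inter_subset_right (finite_Icc 1 n)).trans ?_
    rw [← Finset.coe_Icc, ncard_coe_finset]
    simp
  exact div_le_one_of_le₀ (by exact_mod_cast h) (by positivity)

theorem hasPositiveDensity_multiples {n : ℕ} (hn : 0 < n) :
    HasPositiveDensity (range fun k : ℕ => k * n) := by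
  have hpos : (0 : ℝ) < 1 / (2 * n) := by positivity
  refine hpos.trans_le (le_liminf_of_le ?_ ?_)
  · exact (isBoundedUnder_of ⟨1, density_le_one _⟩).isCoboundedUnder_ge
  · filter_upwards [eventually_ge_atTop n] with M hM
    have hM0 : (0 : ℝ) < M := by exact_mod_cast hn.trans_le hM
    have hsub : (fun k : ℕ => k * n) '' Icc 1 (M / n) ⊆ (range fun k : ℕ => k * n) ∩ Icc 1 M := by
      rintro _ ⟨k, ⟨hk1, hk2⟩, rfl⟩
      exact ⟨⟨k, rfl⟩, Nat.mul_pos hk1 hn, (Nat.le_div_iff_mul_le hn).1 hk2⟩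
    have hcard := ncard_le_ncard hsub ((finite_Icc 1 M).inter_of_right _)
    rw [ncard_image_of_injective _ (mul_left_injective₀ hn.ne'), ← Finset.coe_Icc,
      ncard_coe_finset, Nat.card_Icc, Nat.add_sub_cancel] at hcard
    rw [le_div_iff₀ hM0]
    calc 1 / (2 * (n : ℝ)) * M = M / (2 * n) := by ring
      _ ≤ (M / n : ℕ) := half_le_natDiv hn hM
      _ ≤ _ := by exact_mod_cast hcard

theorem HasPositiveDensity.nontrivial {I : Set ℕ} (h : HasPositiveDensity I) : I.Nontrivial := by
  by_contra hI
  rw [not_nontrivial_iff] at hI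
  have hlim : Tendsto (fun n : ℕ => ((I ∩ Icc 1 n).ncard : ℝ) / n) atTop (𝓝 0) := by
    refine squeeze_zero (fun n => by positivity) (fun n => ?_) tendsto_one_div_atTop_nhds_zero_nat
    have : Finite ↥(I ∩ Icc 1 n) := ((finite_Icc 1 n).inter_of_right _).to_subtype
    have h1 : (I ∩ Icc 1 n).ncard ≤ 1 :=
      ncard_le_one_iff_subsingleton.2 (hI.anti inter_subset_left)
    gcongr
    exact_mod_cast h1
  exact absurd hlim.liminf_eq (ne_of_gt h)

end Independence

/-! ### IE-pairs as chain related pairs -/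

section IEPairs

variable {X : Type*} [MetricSpace X] [CompactSpace X] {T : X → X} {x y z : X}

/-- For times `i < j` in an independence set of small balls, orbit segments of length `j - i`
realise all four choices of balls; moving their endpoints to the centres gives the chains. -/
theorem chainRelated_of_mem_IEPairs (hT : Continuous T) (h : (x, y) ∈ IEPairs T) {δ : ℝ}
    (hδ : 0 < δ) : ChainRelated T δ x y := by
  obtain ⟨η, hη, hp⟩ := HasChain.perturb hT hδ
  obtain ⟨I, hI, hind⟩ := h (Metric.ball x η) (Metric.ball y η) Metric.isOpen_ball
    Metric.isOpen_ball (Metric.mem_ball_self hη) (Metric.mem_ball_self hη)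
  obtain ⟨i, hi, j, hj, hij⟩ := hI.nontrivial.exists_lt
  have key : ∀ a b, Metric.ball a η ∈ ({Metric.ball x η, Metric.ball y η} : Set (Set X)) →
      Metric.ball b η ∈ ({Metric.ball x η, Metric.ball y η} : Set (Set X)) →
      HasChain T δ (j - i) a b := by
    intro a b ha hb
    obtain ⟨z, hz1, hz2⟩ := hind.exists_mem hi hj hij.ne ha hb
    exact hp _ _ _ _ _ (Nat.sub_pos_of_lt hij) (Metric.mem_ball.1 hz1).le
      (Metric.mem_ball.1 hz2).le ((HasChain.iterate T z hij.le).mono hη.le)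
  exact ⟨j - i, Nat.sub_pos_of_lt hij, key _ _ (by simp) (by simp), key _ _ (by simp) (by simp),
    key _ _ (by simp) (by simp), key _ _ (by simp) (by simp)⟩

/-- For the converse, shadowing realises every sequence in `{x, y}` along the multiples of one `n`,
and these multiples form the independence set. -/
theorem mem_IEPairs_iff (hT : Continuous T) (hs : HasShadowing T) :
    (x, y) ∈ IEPairs T ↔ ∀ δ > 0, ChainRelated T δ x y := by
  classical
  refine ⟨fun h δ hδ => chainRelated_of_mem_IEPairs hT h hδ, fun h A₁ A₂ h₁ h₂ hx hy => ?_⟩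
  obtain ⟨ε₁, hε₁, hA₁⟩ := Metric.nhds_basis_closedBall.mem_iff.1 (h₁.mem_nhds hx)
  obtain ⟨ε₂, hε₂, hA₂⟩ := Metric.nhds_basis_closedBall.mem_iff.1 (h₂.mem_nhds hy)
  obtain ⟨n, hn, hσ⟩ := hs.exists_iterate {x, y} (fun δ hδ a ha b hb => by
    have hxy := h δ hδ
    simp only [Finset.mem_insert, Finset.mem_singleton] at ha hb
    rcases ha with rfl | rfl <;> rcases hb with rfl | rfl
    exacts [hxy.refl_left, hxy, hxy.symm, hxy.symm.refl_left]) (lt_min hε₁ hε₂)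
  refine ⟨_, hasPositiveDensity_multiples hn, fun J hJ Y hY => ?_⟩
  obtain ⟨z, hz⟩ := hσ (fun k => if Y (k * n) = A₁ then x else y) fun k => by
    split_ifs <;> simp
  refine ⟨z, ?_⟩
  simp only [mem_iInter, mem_preimage]
  intro j hj
  obtain ⟨k, rfl⟩ := hJ hj
  have hk := hz k
  dsimp only at hk ⊢
  split_ifs at hk with hYk
  · rw [hYk]
    exact hA₁ (Metric.mem_closedBall'.2 (hk.trans (min_le_left _ _)))
  · rw [show Y (k * n) = A₂ from (hY _ hj).resolve_left hYk]
    exact hA₂ (Metric.mem_closedBall'.2 (hk.trans (min_le_right _ _)))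

theorem isClosed_IEPairs {X : Type*} [TopologicalSpace X] (T : X → X) : IsClosed (IEPairs T) := by
  rw [← isOpen_compl_iff, isOpen_iff_mem_nhds]
  intro p hp
  simp only [IEPairs, mem_compl_iff, mem_ofPred_eq, not_forall] at hp
  obtain ⟨A₁, A₂, h₁, h₂, hp₁, hp₂, hI⟩ := hp
  filter_upwards [(h₁.prod h₂).mem_nhds ⟨hp₁, hp₂⟩] with q hq hqE
  exact hI (hqE A₁ A₂ h₁ h₂ hq.1 hq.2)

theorem IEPairs_symm (hT : Continuous T) (hs : HasShadowing T) (h : (x, y) ∈ IEPairs T) :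
    (y, x) ∈ IEPairs T :=
  (mem_IEPairs_iff hT hs).2 fun δ hδ => ((mem_IEPairs_iff hT hs).1 h δ hδ).symm

theorem IEPairs_trans (hT : Continuous T) (hs : HasShadowing T) (h : (x, y) ∈ IEPairs T)
    (h' : (y, z) ∈ IEPairs T) : (x, z) ∈ IEPairs T :=
  (mem_IEPairs_iff hT hs).2 fun δ hδ =>
    ((mem_IEPairs_iff hT hs).1 h δ hδ).trans ((mem_IEPairs_iff hT hs).1 h' δ hδ)

theorem IEPairs_map (hT : Continuous T) (hs : HasShadowing T) (h : (x, y) ∈ IEPairs T) :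
    (T x, T y) ∈ IEPairs T :=
  (mem_IEPairs_iff hT hs).2 fun δ hδ => by
    obtain ⟨η, hη, hmap⟩ := ChainRelated.map hT hδ
    exact hmap _ _ ((mem_IEPairs_iff hT hs).1 h η hη)

theorem IEPairs_eq_chainClosure (hT : Continuous T) (hs : HasShadowing T) :
    IEPairs T = chainClosure (IEPairs T) := by
  refine Subset.antisymm (fun p hp => Relation.TransGen.single hp) ?_
  rintro ⟨u, v⟩ h
  change Relation.TransGen (fun u v => (u, v) ∈ IEPairs T) u v at h
  induction h with
  | single h => exact h
  | tail _ h ih => exact IEPairs_trans hT hs ih h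

end IEPairs

/-! ### Cover entropy under factor maps; UPE implies CPE -/

section Factors

variable {X Y : Type*} {T : X → X} {S : Y → Y} {φ : X → Y}

theorem coverNumber_preimage (hφ : Function.Surjective φ) (𝒰 : Set (Set Y)) :
    coverNumber (preimage φ '' 𝒰) = coverNumber 𝒰 := by
  have hinj : Function.Injective (preimage φ) := hφ.preimage_injective
  have hcov : ∀ 𝒱 : Set (Set Y), ⋃₀ (preimage φ '' 𝒱) = univ ↔ ⋃₀ 𝒱 = univ := fun 𝒱 => by
    rw [sUnion_image, ← preimage_iUnion₂, ← sUnion_eq_biUnion, ← preimage_univ (f := φ), hinj.eq_iff]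
  unfold coverNumber
  congr 1
  ext k
  constructor
  · rintro ⟨_, h, hf, hc, hk⟩
    obtain ⟨𝒱, h𝒱, rfl⟩ := subset_image_iff.1 h
    exact ⟨𝒱, h𝒱, hf.of_finite_image hinj.injOn, (hcov 𝒱).1 hc,
      by rwa [ncard_image_of_injective _ hinj] at hk⟩
  · rintro ⟨𝒱, h, hf, hc, hk⟩
    exact ⟨_, image_mono h, hf.image _, (hcov 𝒱).2 hc, by rwa [ncard_image_of_injective _ hinj]⟩

theorem iterJoin_preimage (h : Function.Semiconj φ T S) (𝒰 : Set (Set Y)) (n : ℕ) :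
    iterJoin T (preimage φ '' 𝒰) n = preimage φ '' iterJoin S 𝒰 n := by
  have key : ∀ U : ℕ → Set Y, ⋂ m ∈ Finset.Icc 1 n, T^[m] ⁻¹' (φ ⁻¹' U m) =
      φ ⁻¹' ⋂ m ∈ Finset.Icc 1 n, S^[m] ⁻¹' U m := fun U => by
    ext x
    simp [(h.iterate_right _).eq]
  ext W
  constructor
  · rintro ⟨U, hU, rfl⟩
    choose! V hV hVU using hU
    refine ⟨_, ⟨V, hV, rfl⟩, ?_⟩
    rw [← key]
    exact iInter₂_congr fun m hm => by rw [hVU m hm]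
  · rintro ⟨_, ⟨U, hU, rfl⟩, rfl⟩
    exact ⟨fun m => φ ⁻¹' U m, fun m hm => mem_image_of_mem _ (hU m hm), (key U).symm⟩

theorem coverEntropy_preimage (hφ : Function.Surjective φ) (h : Function.Semiconj φ T S)
    (𝒰 : Set (Set Y)) : coverEntropy T (preimage φ '' 𝒰) = coverEntropy S 𝒰 := by
  simp only [coverEntropy, iterJoin_preimage h, coverNumber_preimage hφ]

theorem IsCoverByOpens.preimage [TopologicalSpace X] [TopologicalSpace Y] (hφ : Continuous φ)
    {𝒰 : Set (Set Y)} (h : IsCoverByOpens 𝒰) : IsCoverByOpens (Set.preimage φ '' 𝒰) := by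
  refine ⟨?_, ?_⟩
  · rintro _ ⟨U, hU, rfl⟩
    exact (h.1 U hU).preimage hφ
  · rw [sUnion_image, ← preimage_iUnion₂, ← sUnion_eq_biUnion, h.2, preimage_univ]

theorem not_dense_preimage [TopologicalSpace X] [TopologicalSpace Y] (hφ : Continuous φ)
    (hsurj : Function.Surjective φ) {U : Set Y} (hU : ¬ Dense U) : ¬ Dense (φ ⁻¹' U) := fun h =>
  hU <| by simpa [image_preimage_eq _ hsurj] using hsurj.denseRange.dense_image hφ h

theorem HasUPE.hasCPE {X : Type*} [TopologicalSpace X] {T : X → X} (h : HasUPE T) :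
    HasCPE T := by
  intro Y _ _ _ S φ _ hφ hsurj hsemi _
  let _ := TopologicalSpace.metrizableSpaceMetric Y
  obtain ⟨a, b, hab⟩ := exists_pair_ne Y
  -- A third of the distance keeps the closed balls disjoint, so their complements cover.
  have hr : 0 < dist a b / 3 := by have := dist_pos.2 hab; positivity
  have hd : ∀ c : Y, ¬ Dense (Metric.closedBall c (dist a b / 3))ᶜ := fun c hc => by
    obtain ⟨z, hz, hz'⟩ := hc.exists_mem_open Metric.isOpen_ball ⟨c, Metric.mem_ball_self hr⟩
    exact hz (Metric.ball_subset_closedBall hz')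
  have hcov : IsCoverByOpens
      {(Metric.closedBall a (dist a b / 3))ᶜ, (Metric.closedBall b (dist a b / 3))ᶜ} := by
    refine ⟨?_, ?_⟩
    · rintro _ (rfl | rfl) <;> exact Metric.isClosed_closedBall.isOpen_compl
    · rw [sUnion_pair, ← compl_inter, compl_univ_iff]
      exact (Metric.closedBall_disjoint_closedBall (by linarith)).inter_eq
  have hpos := h _ _ (by simpa only [image_pair] using hcov.preimage hφ)
    (not_dense_preimage hφ hsurj (hd a)) (not_dense_preimage hφ hsurj (hd b))
  rw [← image_pair, coverEntropy_preimage hsurj hsemi] at hpos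
  exact lt_of_lt_of_le (by exact_mod_cast hpos)
    (le_iSup₂ (f := fun (𝒰 : Set (Set Y)) (_ : IsCoverByOpens 𝒰) => (coverEntropy S 𝒰 : EReal))
      _ hcov)

theorem HasFiniteUPE.hasUPE {X : Type*} [TopologicalSpace X] {T : X → X} (h : HasFiniteUPE T) :
    HasUPE T := fun U V hc hU hV => h _ (toFinite _) hc <| by
  rintro _ (rfl | rfl) <;> assumption

end Factors

/-! ### Metrizability of quotients by closed relations -/

section Quotients

variable {X Y : Type*} [TopologicalSpace X] [TopologicalSpace Y] {φ : X → Y}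

/-- Distinct fibres are disjoint compact sets; the points whose whole fibres lie in separating open
sets form open neighbourhoods, as `φ` is closed. -/
theorem _root_.IsClosedMap.t2Space_of_surjective [T2Space X] [CompactSpace X] (hcl : IsClosedMap φ)
    (hφ : Continuous φ) (hsurj : Function.Surjective φ) : T2Space Y := by
  have hT1 : ∀ y : Y, IsClosed (φ ⁻¹' {y}) := fun y => by
    obtain ⟨x, rfl⟩ := hsurj y
    have := (hcl {x} isClosed_singleton).preimage hφ
    rwa [image_singleton] at this
  refine ⟨fun y z hyz => ?_⟩
  obtain ⟨U, V, hU, hV, hyU, hzV, hUV⟩ :=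
    SeparatedNhds.of_isCompact_isCompact (hT1 y).isCompact (hT1 z).isCompact
      (Disjoint.preimage φ (disjoint_singleton.2 hyz))
  refine ⟨kernImage φ U, kernImage φ V, isClosedMap_iff_kernImage.1 hcl hU,
    isClosedMap_iff_kernImage.1 hcl hV, fun x hx => hyU hx, fun x hx => hzV hx, ?_⟩
  rw [disjoint_left]
  intro w hw hw'
  obtain ⟨x, hx⟩ := hsurj w
  exact disjoint_left.1 hUV (hw hx) (hw' hx)

/-- A fibre is compact, so finitely many basic open sets cover it inside a given open set; the
kernel images of finite unions of basic sets thus form a countable basis. -/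
theorem _root_.IsClosedMap.secondCountableTopology_of_surjective [T1Space Y] [CompactSpace X]
    [SecondCountableTopology X] (hcl : IsClosedMap φ) (hφ : Continuous φ)
    (hsurj : Function.Surjective φ) : SecondCountableTopology Y := by
  have hB := TopologicalSpace.isBasis_countableBasis X
  have hBc := TopologicalSpace.countable_countableBasis X
  have hopen : ∀ U : Set X, IsOpen U → IsOpen (kernImage φ U) := fun U hU =>
    isClosedMap_iff_kernImage.1 hcl hU
  refine (TopologicalSpace.isTopologicalBasis_of_isOpen_of_nhds
    (s := (fun F => kernImage φ (⋃₀ F)) ''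
      {F : Set (Set X) | F ⊆ TopologicalSpace.countableBasis X ∧ F.Finite}) ?_
    ?_).secondCountableTopology (Set.Countable.image ?_ _)
  · rintro _ ⟨F, ⟨hF, -⟩, rfl⟩
    exact hopen _ (isOpen_sUnion fun U hU => hB.isOpen (hF hU))
  · intro y V hyV hV
    have hK : IsCompact (φ ⁻¹' {y}) := (isClosed_singleton.preimage hφ).isCompact
    obtain ⟨F, hF, hFf, hFc⟩ := hK.elim_finite_subcover_image
      (b := {U ∈ TopologicalSpace.countableBasis X | U ⊆ φ ⁻¹' V}) (c := id)
      (fun U hU => hB.isOpen hU.1) fun x hx => by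
        have hx' : x ∈ φ ⁻¹' V := by
          rw [mem_preimage, mem_singleton_iff.1 hx]
          exact hyV
        obtain ⟨U, hU, hxU, hUV⟩ := hB.exists_subset_of_mem_open hx' (hV.preimage hφ)
        exact mem_biUnion (⟨hU, hUV⟩ : U ∈ {U ∈ TopologicalSpace.countableBasis X | U ⊆ φ ⁻¹' V})
          hxU
    refine ⟨_, ⟨F, ⟨fun U hU => (hF hU).1, hFf⟩, rfl⟩, fun x hx => ?_, fun w hw => ?_⟩
    · simpa [sUnion_eq_biUnion] using hFc hx
    · obtain ⟨x, rfl⟩ := hsurj w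
      obtain ⟨U, hU, hxU⟩ := hw rfl
      exact (hF hU).2 hxU
  · refine (countable_ofPred_finite_subset hBc).mono ?_
    rintro F ⟨h₁, h₂⟩
    exact ⟨h₂, h₁⟩

/-- The saturation of a closed set is the projection of a compact subset of the relation. -/
theorem isClosedMap_quotient_mk [CompactSpace X] [T2Space X] (s : Setoid X)
    (hs : IsClosed {p : X × X | s p.1 p.2}) : IsClosedMap (Quotient.mk s) := by
  intro C hC
  rw [← isQuotientMap_quotient_mk'.isClosed_preimage]
  convert ((hs.inter (hC.preimage continuous_fst)).isCompact.image continuous_snd).isClosed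
  ext x
  constructor
  · rintro ⟨c, hc, hcx⟩
    exact ⟨(c, x), ⟨Quotient.exact hcx, hc⟩, rfl⟩
  · rintro ⟨⟨c, x⟩, ⟨hcx, hc⟩, rfl⟩
    exact ⟨c, hc, Quotient.sound hcx⟩

theorem metrizableSpace_quotient {X : Type*} [MetricSpace X] [CompactSpace X] (s : Setoid X)
    (hs : IsClosed {p : X × X | s p.1 p.2}) : TopologicalSpace.MetrizableSpace (Quotient s) := by
  have hcl := isClosedMap_quotient_mk s hs
  have hc : Continuous (Quotient.mk s) := continuous_quotient_mk'
  have hsurj : Function.Surjective (Quotient.mk s) := Quotient.mk_surjective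
  have := hcl.t2Space_of_surjective hc hsurj
  have := hcl.secondCountableTopology_of_surjective hc hsurj
  infer_instance

end Quotients

/-! ### Positive entropy from avoiding orbits -/

section LowerBound

variable {X : Type*} {T : X → X}

/-- If every sequence of members of a finite cover is avoided by some orbit along the multiples
of `n`, then the iterated joins have large subcovers only. -/
theorem card_pow_le_coverNumber_mul [TopologicalSpace X] [CompactSpace X] [Nonempty X]
    (hT : Continuous T)
    {𝒰 : Set (Set X)} [Fintype 𝒰] (h𝒰 : IsCoverByOpens 𝒰) {n : ℕ} (hn : 0 < n)
    (hσ : ∀ σ : ℕ → 𝒰, ∃ y, ∀ k, T^[k * n] y ∉ (σ k : Set X)) (M : ℕ) :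
    Fintype.card 𝒰 ^ (M / n) ≤
      (Fintype.card 𝒰 - 1) ^ (M / n) * coverNumber (iterJoin T 𝒰 M) := by
  classical
  obtain ⟨𝒲, h𝒲, hf, hc, hN⟩ := exists_coverNumber (isCoverByOpens_iterJoin hT h𝒰 M)
  obtain ⟨U₀⟩ : Nonempty 𝒰 := by
    obtain ⟨U, hU, -⟩ : Classical.arbitrary X ∈ ⋃₀ 𝒰 := h𝒰.2 ▸ mem_univ _
    exact ⟨⟨U, hU⟩⟩
  set q := M / n with hq
  have hy : ∀ σ : Fin q → 𝒰, ∃ W ∈ 𝒲, ∃ y ∈ W, ∀ k : Fin q,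
      T^[(k + 1 : ℕ) * n] y ∉ (σ k : Set X) := by
    intro σ
    -- The shift by one is needed because the join starts at time 1; `U₀` fills the unused times.
    obtain ⟨y, hy⟩ := hσ fun k => if h : k - 1 < q then σ ⟨k - 1, h⟩ else U₀
    obtain ⟨W, hW, hyW⟩ : y ∈ ⋃₀ 𝒲 := hc ▸ mem_univ y
    exact ⟨W, hW, y, hyW, fun k => by simpa using hy (k + 1)⟩
  choose W hW y hyW hyσ using hy
  have hcard := Finset.card_le_mul_card_image_of_maps_to
    (s := (Finset.univ : Finset (Fin q → 𝒰))) (t := hf.toFinset) (f := W)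
    (fun σ _ => by simpa using hW σ) ((Fintype.card 𝒰 - 1) ^ q) ?_
  · rwa [Finset.card_univ, Fintype.card_fun, Fintype.card_fin, ← ncard_eq_toFinset_card _ hf,
      hN] at hcard
  · intro V hV
    obtain ⟨U, hU, rfl⟩ := h𝒲 (hf.mem_toFinset.1 hV)
    have hmem : ∀ k : Fin q, (k + 1 : ℕ) * n ∈ Finset.Icc 1 M := fun k => by
      rw [Finset.mem_Icc]
      exact ⟨Nat.mul_pos k.1.succ_pos hn, (Nat.le_div_iff_mul_le hn).1 k.2⟩
    -- A word assigned to this join element must differ from `U` at each of the `q` sampled times,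
    -- which leaves one choice fewer per letter.
    calc _ ≤ (Fintype.piFinset fun k : Fin q => Finset.univ.erase
          (⟨U ((k + 1 : ℕ) * n), hU _ (hmem k)⟩ : 𝒰)).card := by
          refine Finset.card_le_card fun σ hσV => ?_
          rw [Finset.mem_filter] at hσV
          rw [Fintype.mem_piFinset]
          intro k
          rw [Finset.mem_erase]
          refine ⟨fun he => ?_, Finset.mem_univ _⟩
          have h1 := hyW σ
          rw [hσV.2, mem_iInter₂] at h1
          exact hyσ σ k (by rw [he]; exact h1 _ (hmem k))
      _ = (Fintype.card 𝒰 - 1) ^ q := by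
          simp [Fintype.card_piFinset, Finset.card_erase_of_mem, Finset.card_univ]

/-- With `r` members in the cover, `N ≥ (r / (r - 1)) ^ (M / n)`, so the entropy is at least `log (r
/ (r - 1)) / (2 * n)`. -/
theorem coverEntropy_pos_of_avoiding [TopologicalSpace X] [CompactSpace X] [Nonempty X]
    (hT : Continuous T) {𝒰 : Set (Set X)} (hfin : 𝒰.Finite) (h𝒰 : IsCoverByOpens 𝒰) {n : ℕ}
    (hn : 0 < n) (hσ : ∀ σ : ℕ → 𝒰, ∃ y, ∀ k, T^[k * n] y ∉ (σ k : Set X)) :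
    0 < coverEntropy T 𝒰 := by
  classical
  have := hfin.fintype
  have hk : 1 < Fintype.card 𝒰 := by
    obtain ⟨U, hU, -⟩ : Classical.arbitrary X ∈ ⋃₀ 𝒰 := h𝒰.2 ▸ mem_univ _
    obtain ⟨y, hy⟩ := hσ fun _ => ⟨U, hU⟩
    obtain ⟨V, hV, hyV⟩ : T^[0 * n] y ∈ ⋃₀ 𝒰 := h𝒰.2 ▸ mem_univ _
    refine Fintype.one_lt_card_iff.2 ⟨⟨U, hU⟩, ⟨V, hV⟩, fun h => ?_⟩
    rw [Subtype.mk.injEq] at h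
    exact hy 0 (h ▸ hyV)
  have hk' : (1 : ℝ) < Fintype.card 𝒰 := by exact_mod_cast hk
  set c : ℝ := Real.log (Fintype.card 𝒰) - Real.log (Fintype.card 𝒰 - 1) with hc
  have hc0 : 0 < c := sub_pos.2 (Real.log_lt_log (by linarith) (by linarith))
  have hpos : 0 < c / (2 * n) := by positivity
  refine hpos.trans_le (ge_of_tendsto (tendsto_coverEntropy hT h𝒰) ?_)
  filter_upwards [eventually_ge_atTop n] with M hM
  have hM0 : (0 : ℝ) < M := by exact_mod_cast hn.trans_le hM
  have hN : (0 : ℝ) < coverNumber (iterJoin T 𝒰 M) := by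
    exact_mod_cast coverNumber_pos (isCoverByOpens_iterJoin hT h𝒰 M)
  have hcount : (Fintype.card 𝒰 : ℝ) ^ (M / n) ≤
      ((Fintype.card 𝒰 : ℝ) - 1) ^ (M / n) * coverNumber (iterJoin T 𝒰 M) := by
    have := card_pow_le_coverNumber_mul hT h𝒰 hn hσ M
    have h1 : ((Fintype.card 𝒰 - 1 : ℕ) : ℝ) = (Fintype.card 𝒰 : ℝ) - 1 := by
      rw [Nat.cast_sub hk.le, Nat.cast_one]
    rw [← h1]
    exact_mod_cast this
  have hlog := Real.log_le_log (by positivity) hcount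
  rw [Real.log_mul (pow_pos (by linarith) _).ne' hN.ne', Real.log_pow, Real.log_pow] at hlog
  have hq : (M / n : ℕ) * c ≤ Real.log (coverNumber (iterJoin T 𝒰 M)) := by
    rw [hc]; linarith
  rw [le_div_iff₀ hM0]
  calc c / (2 * n) * M = M / (2 * n) * c := by ring
    _ ≤ (M / n : ℕ) * c := by gcongr; exact half_le_natDiv hn hM
    _ ≤ _ := hq

/-- If all pairs of distinct points are IE-pairs, finite covers by non-dense sets have positive
entropy. -/
theorem hasFiniteUPE_of_forall_mem_IEPairs {X : Type*} [MetricSpace X] [CompactSpace X]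
    [Nonempty X] {T : X → X} (hT : Continuous T) (hs : HasShadowing T)
    (h : ∀ x y, x ≠ y → (x, y) ∈ IEPairs T) : HasFiniteUPE T := by
  classical
  intro 𝒰 hfin h𝒰 hd
  have := hfin.fintype
  have hx : ∀ U : 𝒰, ∃ x, ∃ ε > 0, ∀ z, dist x z ≤ ε → z ∉ (U : Set X) := by
    intro U
    have := hd U U.2
    simp only [Dense, not_forall] at this
    obtain ⟨x, hx⟩ := this
    obtain ⟨ε, hε, hball⟩ := Metric.nhds_basis_closedBall.mem_iff.1
      (isClosed_closure.isOpen_compl.mem_nhds hx)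
    exact ⟨x, ε, hε, fun z hz hzU => hball (Metric.mem_closedBall'.2 hz) (subset_closure hzU)⟩
  choose x ε hε hxε using hx
  obtain ⟨ε₀, hε₀, hle⟩ : ∃ ε₀ > 0, ∀ U, ε₀ ≤ ε U := by
    rcases isEmpty_or_nonempty 𝒰 with hem | hne
    · exact ⟨1, one_pos, fun U => hem.elim U⟩
    · obtain ⟨U, hU⟩ := Finite.exists_min ε
      exact ⟨ε U, hε U, hU⟩
  -- The hypothesis covers distinct points only; a second point `x W` yields the diagonal pairs by
  -- transitivity.
  have hother : ∀ z, ∃ W : 𝒰, x W ≠ z := fun z => by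
    obtain ⟨W, hW, hzW⟩ : z ∈ ⋃₀ 𝒰 := h𝒰.2 ▸ mem_univ _
    exact ⟨⟨W, hW⟩, fun he => hxε ⟨W, hW⟩ z (by simp [he, (hε _).le]) hzW⟩
  have hE : ∀ y z, y ∈ range x → z ∈ range x → (y, z) ∈ IEPairs T := by
    rintro y z - -
    by_cases hyz : y = z
    · subst hyz
      obtain ⟨W, hW⟩ := hother y
      exact IEPairs_trans hT hs (h _ _ hW.symm) (h _ _ hW)
    · exact h _ _ hyz
  obtain ⟨n, hn, hsh⟩ := hs.exists_iterate (Finset.univ.image x) (fun δ hδ a ha b hb =>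
    (mem_IEPairs_iff hT hs).1 (hE a b (by simpa using ha) (by simpa using hb)) δ hδ) hε₀
  refine coverEntropy_pos_of_avoiding hT hfin h𝒰 hn fun σ => ?_
  obtain ⟨y, hy⟩ := hsh (fun k => x (σ k)) fun k => by simp
  exact ⟨y, fun k => hxε _ _ ((hy k).trans (hle _))⟩

end LowerBound

/-! ### Polynomial growth for saturated covers -/

section UpperBound

/-- The first time at which `w` visits `p`, truncated at `N`. -/
noncomputable def hitTime {X : Type*} (w : ℕ → X) (p : X) (N : ℕ) : ℕ :=
  sInf (insert N {i | w i = p})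

theorem hitTime_le {X : Type*} (w : ℕ → X) (p : X) (N : ℕ) : hitTime w p N ≤ N :=
  Nat.sInf_le (mem_insert _ _)

theorem hitTime_le_of_eq {X : Type*} {w : ℕ → X} {p : X} (N : ℕ) {i : ℕ} (h : w i = p) :
    hitTime w p N ≤ i :=
  Nat.sInf_le (mem_insert_of_mem _ h)

theorem apply_hitTime {X : Type*} {w : ℕ → X} {p : X} {N : ℕ} (h : hitTime w p N < N) :
    w (hitTime w p N) = p :=
  (Nat.sInf_mem (insert_nonempty N {i | w i = p})).resolve_left h.ne

variable {X : Type*} [MetricSpace X] {T : X → X} {δ : ℝ}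

/-- The first visiting times of a pseudo-orbit determine its itinerary up to chain relatedness. -/
theorem chainRelated_of_hitTime_eq {w w' : ℕ → X} (hw : ∀ i, dist (T (w i)) (w (i + 1)) ≤ δ)
    (hw' : ∀ i, dist (T (w' i)) (w' (i + 1)) ≤ δ) {n : ℕ}
    (h : ∀ i, hitTime w (w i) (n + 1) = hitTime w' (w i) (n + 1))
    (h' : ∀ i, hitTime w (w' i) (n + 1) = hitTime w' (w' i) (n + 1)) {i : ℕ} (hi : i ≤ n) :
    w i = w' i ∨ ChainRelated T δ (w i) (w' i) := by
  -- If `w` meets a point for the first time at `i`, equal hitting times force `w'` to be there as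
  -- well.
  have hnew : ∀ i ≤ n, hitTime w (w i) (n + 1) = i → w i = w' i := fun i hi hit => by
    have e := (h i).symm.trans hit
    have := apply_hitTime (w := w') (p := w i) (N := n + 1) (by omega)
    rw [e] at this
    exact this.symm
  have hnew' : ∀ i ≤ n, hitTime w' (w' i) (n + 1) = i → w i = w' i := fun i hi hit => by
    have e := (h' i).trans hit
    have := apply_hitTime (w := w) (p := w' i) (N := n + 1) (by omega)
    rwa [e] at this
  induction i with
  | zero =>
    exact .inl (hnew 0 hi (Nat.le_zero.1 (hitTime_le_of_eq (w := w) _ rfl)))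
  | succ i ih =>
    by_cases h1 : hitTime w (w (i + 1)) (n + 1) = i + 1
    · exact .inl (hnew _ hi h1)
    by_cases h2 : hitTime w' (w' (i + 1)) (n + 1) = i + 1
    · exact .inl (hnew' _ hi h2)
    -- Neither point is new, so each sequence supplies a chain from its point at `i + 1` back to its
    -- point at `i`, and the recurrent step lemma applies.
    have h3 : hitTime w (w (i + 1)) (n + 1) ≤ i := by
      have := hitTime_le_of_eq (w := w) (n + 1) (rfl : w (i + 1) = w (i + 1))
      omega
    have h4 : hitTime w' (w' (i + 1)) (n + 1) ≤ i := by
      have := hitTime_le_of_eq (w := w') (n + 1) (rfl : w' (i + 1) = w' (i + 1))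
      omega
    have r1 := HasChain.of_seq hw h3
    have r2 := HasChain.of_seq hw' h4
    rw [apply_hitTime (h3.trans_lt (by omega))] at r1
    rw [apply_hitTime (h4.trans_lt (by omega))] at r2
    have s1 := HasChain.of_seq hw (Nat.le_succ i)
    have s2 := HasChain.of_seq hw' (Nat.le_succ i)
    rw [Nat.succ_eq_add_one, Nat.add_sub_cancel_left] at s1 s2
    exact .inr (ChainRelated.step (ih (by omega)) s1 r1 s2 r2)

/-- The table of first visit times to `P`, with values in `0, …, n + 1`, determines the itinerary up
to chain relatedness, so one join element per table suffices. -/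
theorem coverNumber_iterJoin_le [Nonempty X] {𝒰 : Set (Set X)} {P : Finset X} {π : X → X}
    (hπP : ∀ x, π x ∈ P) (hπ : ∀ x, dist (π x) x ≤ δ) (hstep : ∀ x, dist (T (π x)) (π (T x)) ≤ δ)
    (hδ : ∀ p, ∃ V ∈ 𝒰, ∀ q, (p = q ∨ ChainRelated T δ p q) → Metric.closedBall q δ ⊆ V) (n : ℕ) :
    coverNumber (iterJoin T 𝒰 n) ≤ (n + 2) ^ P.card := by
  classical
  choose V hV𝒰 hV using hδ
  let code : X → P → Fin (n + 2) := fun x p =>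
    ⟨hitTime (fun i => π (T^[i] x)) p (n + 1), Nat.lt_succ_of_le (hitTime_le _ _ _)⟩
  let W : (P → Fin (n + 2)) → Set X := fun c =>
    ⋂ m ∈ Finset.Icc 1 n, T^[m] ⁻¹' V (π (T^[m] (Function.invFun code c)))
  have hs : ∀ x i, dist (T (π (T^[i] x))) (π (T^[i + 1] x)) ≤ δ := fun x i => by
    rw [Function.iterate_succ_apply']
    exact hstep _
  have hcard : (range W).ncard ≤ (n + 2) ^ P.card := by
    rw [← image_univ]
    refine (ncard_image_le finite_univ).trans ?_
    rw [ncard_univ, Nat.card_eq_fintype_card]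
    simp
  refine le_trans (Nat.sInf_le ⟨range W, ?_, finite_range W, ?_, rfl⟩) hcard
  · rintro _ ⟨c, rfl⟩
    exact ⟨_, fun m _ => hV𝒰 _, rfl⟩
  · refine eq_univ_of_forall fun x => ⟨W (code x), mem_range_self _, ?_⟩
    have hcode : code (Function.invFun code (code x)) = code x := Function.invFun_eq ⟨x, rfl⟩
    set y := Function.invFun code (code x) with hy
    have hhit : ∀ p ∈ P, hitTime (fun i => π (T^[i] y)) p (n + 1) =
        hitTime (fun i => π (T^[i] x)) p (n + 1) := fun p hp =>
      congrArg Fin.val (congrFun hcode ⟨p, hp⟩)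
    refine mem_iInter₂.2 fun m hm => ?_
    have hrel := chainRelated_of_hitTime_eq (hs y) (hs x) (fun i => hhit _ (hπP _))
      (fun i => hhit _ (hπP _)) (Finset.mem_Icc.1 hm).2
    exact hV _ _ hrel (Metric.mem_closedBall'.2 (hπ _))

theorem coverEntropy_nonpos_of_coverNumber_le [CompactSpace X] [Nonempty X] (hT : Continuous T)
    {𝒰 : Set (Set X)} (h𝒰 : IsCoverByOpens 𝒰) {K : ℕ}
    (h : ∀ n, coverNumber (iterJoin T 𝒰 n) ≤ (n + 2) ^ K) : coverEntropy T 𝒰 ≤ 0 := by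
  have hlim : Tendsto (fun n : ℕ => (K : ℝ) * (Real.log (n + 2) / n)) atTop (𝓝 0) := by
    -- Evaluating `log x / (x - 2)` at `x = n + 2` leaves the denominator `n`.
    have h1 := (Real.tendsto_pow_log_div_mul_add_atTop 1 (-2) 1 one_ne_zero).comp
      (tendsto_natCast_atTop_atTop.comp (tendsto_add_atTop_nat 2))
    simpa [Function.comp_def] using h1.const_mul (K : ℝ)
  refine le_of_tendsto_of_tendsto' (tendsto_coverEntropy hT h𝒰) hlim fun n => ?_
  rw [← mul_div_assoc]
  gcongr
  have hN : (0 : ℝ) < coverNumber (iterJoin T 𝒰 n) := by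
    exact_mod_cast coverNumber_pos (isCoverByOpens_iterJoin hT h𝒰 n)
  rw [← Real.log_pow]
  exact Real.log_le_log hN (by exact_mod_cast h n)

variable [CompactSpace X]

/-- A Lebesgue number argument: counterexamples at scales tending to zero converge to a point `a` of
some member `V` and a point `b` outside it that is chain related to `a` at every scale, against
saturation. -/
theorem exists_chainRelated_subset (hT : Continuous T) {𝒰 : Set (Set X)} (h𝒰 : IsCoverByOpens 𝒰)
    (hsat : ∀ U ∈ 𝒰, ∀ x ∈ U, ∀ y, (∀ δ > 0, ChainRelated T δ x y) → y ∈ U) :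
    ∃ δ > 0, ∀ p, ∃ V ∈ 𝒰, ∀ q, (p = q ∨ ChainRelated T δ p q) → Metric.closedBall q δ ⊆ V := by
  by_contra! hcon
  choose p hp using fun k : ℕ => hcon (1 / (k + 1)) (by positivity)
  obtain ⟨a, f, hf, hpa⟩ := CompactSpace.tendsto_subseq p
  obtain ⟨V, hV, haV⟩ : a ∈ ⋃₀ 𝒰 := h𝒰.2 ▸ mem_univ a
  choose q hq hqV using fun k => hp k V hV
  simp only [not_subset] at hqV
  choose r hr hrV using hqV
  obtain ⟨b, g, hg, hqb⟩ := CompactSpace.tendsto_subseq (q ∘ f)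
  have hδ : Tendsto (fun k => (1 : ℝ) / ((f (g k) : ℕ) + 1)) atTop (𝓝 0) :=
    tendsto_one_div_add_atTop_nhds_zero_nat.comp (hf.comp hg).tendsto_atTop
  have hpa' : Tendsto (fun k => p (f (g k))) atTop (𝓝 a) := hpa.comp hg.tendsto_atTop
  have hqb' : Tendsto (fun k => q (f (g k))) atTop (𝓝 b) := hqb
  have hrb : Tendsto (fun k => r (f (g k))) atTop (𝓝 b) := by
    refine hqb'.congr_dist (squeeze_zero (fun _ => dist_nonneg) (fun k => ?_) hδ)
    exact Metric.mem_closedBall'.1 (hr (f (g k)))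
  have hbV : b ∉ V := (h𝒰.1 V hV).isClosed_compl.mem_of_tendsto hrb (.of_forall fun k => hrV _)
  have hab : a ≠ b := fun h => hbV (h ▸ haV)
  refine hbV (hsat V hV a haV b fun δ hδ0 => ?_)
  obtain ⟨η, hη, hpert⟩ := ChainRelated.perturb hT hδ0
  obtain ⟨k, hk1, hk2, hk3, hk4⟩ := ((hpa'.eventually (Metric.closedBall_mem_nhds a hη)).and
    ((hqb'.eventually (Metric.closedBall_mem_nhds b hη)).and
      ((hδ.eventually_le_const hη).and ((hpa'.prodMk_nhds hqb').eventually
        (isClosed_diagonal.isOpen_compl.mem_nhds hab))))).exists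
  exact hpert _ _ _ _ hk1 hk2 (((hq (f (g k))).resolve_left hk4).mono hk3)

/-- Rounding orbits to a fine finite net turns them into `δ`-pseudo-orbits in a finite set, where
visit times can be counted. -/
theorem coverEntropy_nonpos_of_saturated [Nonempty X] (hT : Continuous T) {𝒰 : Set (Set X)}
    (h𝒰 : IsCoverByOpens 𝒰)
    (hsat : ∀ U ∈ 𝒰, ∀ x ∈ U, ∀ y, (∀ δ > 0, ChainRelated T δ x y) → y ∈ U) :
    coverEntropy T 𝒰 ≤ 0 := by
  obtain ⟨δ, hδ, hV⟩ := exists_chainRelated_subset hT h𝒰 hsat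
  obtain ⟨r, hr, hTr⟩ := Metric.uniformContinuous_iff.1
    (CompactSpace.uniformContinuous_of_continuous hT) (δ / 2) (by positivity)
  obtain ⟨t, -, htf, ht⟩ := (isCompact_univ (X := X)).finite_cover_balls
    (e := min r (δ / 2)) (by positivity)
  have hπ : ∀ x, ∃ p ∈ htf.toFinset, dist p x < min r (δ / 2) := fun x => by
    obtain ⟨p, hp, hx⟩ := mem_iUnion₂.1 (ht (mem_univ x))
    exact ⟨p, by simpa using hp, Metric.mem_ball'.1 hx⟩
  choose π hπP hπ using hπ
  refine coverEntropy_nonpos_of_coverNumber_le hT h𝒰 (coverNumber_iterJoin_le hπP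
    (fun x => ?_) (fun x => ?_) hV)
  · have := (hπ x).trans_le (min_le_right _ _)
    linarith
  · have h1 := hTr ((hπ x).trans_le (min_le_left _ _))
    have h2 := (hπ (T x)).trans_le (min_le_right _ _)
    rw [dist_comm] at h2
    linarith [dist_triangle (T (π x)) (T x) (π (T x))]

end UpperBound

/-! ### The quotient by IE-pairs and the main theorem -/

section Main

variable {X : Type*} [MetricSpace X] [CompactSpace X] {T : X → X}

/-- Equality or being an IE-pair, as an equivalence relation. -/
def ieSetoid (hT : Continuous T) (hs : HasShadowing T) : Setoid X where
  r x y := x = y ∨ (x, y) ∈ IEPairs T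
  iseqv := {
    refl := fun _ => .inl rfl
    symm := fun h => h.imp Eq.symm (IEPairs_symm hT hs)
    trans := by
      rintro x y z (rfl | h) (rfl | h')
      exacts [.inl rfl, .inr h', .inr h, .inr (IEPairs_trans hT hs h h')] }

/-- The quotient by the IE-pairs is a factor of zero entropy, hence trivial under CPE. -/
theorem mem_IEPairs_of_hasCPE [Nonempty X] (hT : Continuous T) (hs : HasShadowing T)
    (h : HasCPE T) {x y : X} (hxy : x ≠ y) : (x, y) ∈ IEPairs T := by
  by_contra hE
  let s := ieSetoid hT hs
  have hmap : ∀ a b, s a b → s (T a) (T b) := fun a b hab =>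
    hab.imp (congrArg T) (IEPairs_map hT hs)
  let S : Quotient s → Quotient s := Quotient.map T hmap
  have hc : Continuous (Quotient.mk s) := continuous_quotient_mk'
  have hsurj : Function.Surjective (Quotient.mk s) := Quotient.mk_surjective
  have hsemi : Function.Semiconj (Quotient.mk s) T S := fun _ => rfl
  have hclosed : IsClosed {p : X × X | s p.1 p.2} := isClosed_diagonal.union (isClosed_IEPairs T)
  have := metrizableSpace_quotient s hclosed
  have : Nontrivial (Quotient s) :=
    ⟨Quotient.mk s x, Quotient.mk s y, fun he => (Quotient.exact he).elim hxy hE⟩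
  have hS : Continuous S := (hc.comp hT).quotient_lift _
  refine absurd (h (Quotient s) S (Quotient.mk s) hS hc hsurj hsemi this) (not_lt.2 ?_)
  refine iSup₂_le fun 𝒰 h𝒰 => ?_
  rw [← coverEntropy_preimage hsurj hsemi]
  refine EReal.coe_nonpos.2 (coverEntropy_nonpos_of_saturated hT (h𝒰.preimage hc) ?_)
  rintro _ ⟨U, -, rfl⟩ a ha b hab
  have hs' : Quotient.mk s a = Quotient.mk s b :=
    Quotient.sound (.inr ((mem_IEPairs_iff hT hs).2 hab))
  rwa [mem_preimage, ← hs']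

end Main

end LocalEntropy

theorem mainTheorem5 {X : Type*} [MetricSpace X] [CompactSpace X] [Nonempty X]
    (T : X → X) (hT : Continuous T) (hshadow : LocalEntropy.HasShadowing T) :
    LocalEntropy.IEPairs T = LocalEntropy.chainClosure (LocalEntropy.IEPairs T) ∧
    (LocalEntropy.HasUPE T ↔ LocalEntropy.HasCPE T) ∧
    (LocalEntropy.HasFiniteUPE T ↔ LocalEntropy.HasCPE T) := by
  have h : LocalEntropy.HasCPE T → LocalEntropy.HasFiniteUPE T := fun h =>
    LocalEntropy.hasFiniteUPE_of_forall_mem_IEPairs hT hshadow fun _ _ hxy =>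
      LocalEntropy.mem_IEPairs_of_hasCPE hT hshadow h hxy
  exact ⟨LocalEntropy.IEPairs_eq_chainClosure hT hshadow,
    ⟨fun hU => hU.hasCPE, fun hC => (h hC).hasUPE⟩, ⟨fun hF => hF.hasUPE.hasCPE, h⟩⟩
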